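/- For a positive integer $n$, let $\rho(n)=|\mathcal X'_n|/|\mathcal X_n|$, where $\mathcal X_n$ is the set of (complex) Dirichlet characters modulo $n$ and $\mathcal X'_n\subseteq\mathcal X_n$ is the subset of primitive characters. Let $\omega(n)$ be the number of distinct prime divisors of $n$, let $n_k$ be the product of the first $k$ primes, let $\gamma$ be the Euler–Mascheroni constant, and let $$C_2=\prod_{p>2}\frac{p(p-2)}{(p-1)^2}$$ (product over primes $p>2$) be the twin prime constant. Then $$\liminf_{\substack{n\to\infty\\ n\not\equiv 2\ (\mathrm{mod}\ 4)}}\rho(n)\log\log n=C_2\,e^{-\gamma}.$$ Moreover: (a) for every fixed integer $k>1$, among the positive integers $n\not\equiv 2\pmod 4$ with $\omega(n)=k$, the value $\rho(n)\log\log n$ is minimised at $n=2n_k$; that is, $2n_k\not\equiv 2\pmod 4$, $\omega(2n_k)=k$, and $$\rho(2n_k)\log\log(2n_k)\le\rho(n)\log\log n\qquad\text{for all } n\not\equiv 2\ (\mathrm{mod}\ 4) \text{ with } \omega(n)=k;$$ (b) $\displaystyle\lim_{k\to\infty}\rho(2n_k)\log\log(2n_k)=C_2\,e^{-\gamma}.$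 -/

import Mathlib

/-- The proportion `|X'_n| / |X_n|` of Dirichlet characters mod `n` that are primitive. -/
noncomputable def primitiveProportion (n : ℕ) : ℝ :=
  (Nat.card {χ : DirichletCharacter ℂ n // χ.IsPrimitive} : ℝ) /
    (Nat.card (DirichletCharacter ℂ n) : ℝ)

/-- The product of the first `k` primes (`Nat.nth Nat.Prime 0 = 2`). -/
noncomputable def primeProd (k : ℕ) : ℕ :=
  ∏ i ∈ Finset.range k, Nat.nth Nat.Prime i

/-- The twin prime constant: the product of `p (p - 2) / (p - 1) ^ 2` over all primes `p > 2`. -/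
noncomputable def twinPrimeConstant : ℝ :=
  ∏' p : {p : ℕ // p.Prime ∧ 2 < p}, ((p : ℕ) : ℝ) * ((p : ℕ) - 2 : ℝ) / ((p : ℕ) - 1 : ℝ) ^ 2

/-- The product defining the twin prime constant converges. -/
theorem multipliable_twinPrimeConstant :
    Multipliable fun p : {p : ℕ // p.Prime ∧ 2 < p} =>
      ((p : ℕ) : ℝ) * ((p : ℕ) - 2 : ℝ) / ((p : ℕ) - 1 : ℝ) ^ 2 := by
  have hs : Summable fun p : {p : ℕ // p.Prime ∧ 2 < p} => -(1 / ((p : ℕ) - 1 : ℝ) ^ 2) := by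
    have h0 : Summable fun n : ℕ => 4 * (1 / (n : ℝ) ^ 2) :=
      (Real.summable_one_div_nat_pow.mpr one_lt_two).mul_left 4
    have h1 := h0.comp_injective
      (Subtype.val_injective : Function.Injective (Subtype.val : {p : ℕ // p.Prime ∧ 2 < p} → ℕ))
    refine (Summable.of_nonneg_of_le (fun p => by positivity) (fun p => ?_) h1).neg
    have hp : (2 : ℝ) < ((p : ℕ) : ℝ) := by exact_mod_cast p.2.2
    simp only [Function.comp]
    rw [mul_one_div, div_le_div_iff₀ (by nlinarith) (by positivity)]
    nlinarith
  refine (Real.multipliable_one_add_of_summable hs).congr fun p => ?_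
  have hp : (2 : ℝ) < ((p : ℕ) : ℝ) := by exact_mod_cast p.2.2
  have h1 : ((p : ℕ) : ℝ) - 1 ≠ 0 := by linarith
  field_simp
  ring

/-! Sorting the characters mod n by conductor writes φ as the divisor sum of the number of primitive
characters. That number is therefore multiplicative, and ρ(n) is a product of local factors:
(p-2)/(p-1) if p divides n exactly once, 1-1/p if p² divides n. A single factor 2 would contribute
0, hence the exclusion of n ≡ 2 (mod 4). The least remaining factor, `minLocalProportion p`, does
not decrease with p, so among n with k prime factors ρ is least at 2n_k. For k > 1 this is also the
smallest such n, so both factors of ρ(n) log log n are minimal there.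

Along 2n_k, the identity (p-2)/(p-1) = p(p-2)/(p-1)² · (1-1/p) splits ρ into a partial product of C₂
and a Mertens product, while Chebyshev's bounds give log log(2n_k) ~ log p_k. For the liminf,
integers with many prime factors are compared with 2n_k; those with few have ρ bounded below, so
ρ(n) log log n is eventually large.

The main analytic input is Mertens' third theorem. The factorization of N! and Dirichlet's test show
that the sum of -log(1-1/p) over p < N, minus log log N, converges. Abel's limit theorem identifies
the limit as γ, by setting log ζ(1+σ) as σ → 0+ against the series of x^m/m. -/

open Filter Topology

/-! ### Counting primitive characters -/

/-- Every Dirichlet character mod `n` is induced by exactly one primitive character, of some level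
dividing `n`. -/
theorem bijective_changeLevel_primitive (n : ℕ) [NeZero n] :
    Function.Bijective (fun x : (d : n.divisors) ×
        {χ : DirichletCharacter ℂ (d : ℕ) // χ.IsPrimitive} =>
      DirichletCharacter.changeLevel (Nat.dvd_of_mem_divisors x.1.2) x.2.1) := by
  constructor
  · rintro ⟨⟨d, hd⟩, ⟨χ, hχ⟩⟩ ⟨⟨e, he⟩, ⟨ψ, hψ⟩⟩ h
    dsimp only at h
    have hc := congrArg DirichletCharacter.conductor h
    rw [DirichletCharacter.conductor_changeLevel, DirichletCharacter.conductor_changeLevel] at hc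
    have hde : d = e := by
      have h1 : χ.conductor = d := hχ
      have h2 : ψ.conductor = e := hψ
      rw [← h1, ← h2, hc]
    subst hde
    have := DirichletCharacter.changeLevel_injective (Nat.dvd_of_mem_divisors hd) h
    subst this
    rfl
  · intro χ
    exact ⟨⟨⟨χ.conductor, Nat.mem_divisors.mpr ⟨χ.conductor_dvd_level, NeZero.ne n⟩⟩,
      ⟨χ.primitiveCharacter, χ.primitiveCharacter_isPrimitive⟩⟩, χ.changeLevel_primitiveCharacter⟩

/-- The number of primitive Dirichlet characters of level `n`, as an arithmetic function. -/
noncomputable def primitiveCount : ArithmeticFunction ℤ :=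
  ⟨fun n => if n = 0 then 0 else
    (Nat.card {χ : DirichletCharacter ℂ n // χ.IsPrimitive} : ℤ), if_pos rfl⟩

theorem primitiveCount_apply {n : ℕ} (hn : n ≠ 0) :
    primitiveCount n = Nat.card {χ : DirichletCharacter ℂ n // χ.IsPrimitive} :=
  if_neg hn

theorem sum_divisors_primitiveCount {n : ℕ} (hn : 0 < n) :
    ∑ d ∈ n.divisors, primitiveCount d = (n.totient : ℤ) := by
  have : NeZero n := ⟨hn.ne'⟩
  rw [← DirichletCharacter.card_eq_totient_of_hasEnoughRootsOfUnity ℂ n,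
    ← Nat.card_congr (Equiv.ofBijective _ (bijective_changeLevel_primitive n))]
  have hfin : ∀ d : n.divisors,
      Finite {χ : DirichletCharacter ℂ (d : ℕ) // χ.IsPrimitive} := fun d => by
    have : NeZero (d : ℕ) := ⟨(Nat.pos_of_mem_divisors d.2).ne'⟩
    infer_instance
  rw [Nat.card_sigma]
  push_cast
  rw [← Finset.sum_coe_sort n.divisors]
  exact Finset.sum_congr rfl fun d _ =>
    primitiveCount_apply (Nat.pos_of_mem_divisors d.2).ne'

/-- Euler's totient as an arithmetic function. -/
def totientArith : ArithmeticFunction ℤ := ⟨fun n => n.totient, by simp⟩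

theorem isMultiplicative_totientArith : totientArith.IsMultiplicative :=
  ⟨by simp [totientArith], fun {m n} h => by simp [totientArith, Nat.totient_mul h]⟩

/-- Möbius inversion of the divisor sum gives μ * φ, a convolution of multiplicative functions. -/
theorem isMultiplicative_primitiveCount : primitiveCount.IsMultiplicative := by
  have h : primitiveCount = ArithmeticFunction.moebius * totientArith := by
    ext n
    rcases Nat.eq_zero_or_pos n with rfl | hn
    · simp
    have := ArithmeticFunction.sum_eq_iff_sum_mul_moebius_eq.mp
      (fun n (hn : n > 0) => sum_divisors_primitiveCount hn) n hn
    rw [← this, ArithmeticFunction.mul_apply]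
    simp [totientArith]
  rw [h]
  exact ArithmeticFunction.isMultiplicative_moebius.mul isMultiplicative_totientArith

theorem primitiveCount_prime_pow {p : ℕ} (hp : p.Prime) (a : ℕ) :
    primitiveCount (p ^ (a + 1)) =
      ((p ^ (a + 1)).totient : ℤ) - ((p ^ a).totient : ℤ) := by
  rw [← sum_divisors_primitiveCount (pow_pos hp.pos _),
    ← sum_divisors_primitiveCount (pow_pos hp.pos _), Nat.sum_divisors_prime_pow hp,
    Nat.sum_divisors_prime_pow hp, Finset.sum_range_succ _ (a + 1)]
  ring

theorem primitiveCount_prime {p : ℕ} (hp : p.Prime) : primitiveCount p = (p : ℤ) - 2 := by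
  have h := primitiveCount_prime_pow hp 0
  simp only [zero_add, pow_one, pow_zero, Nat.totient_one, Nat.totient_prime hp] at h
  rw [h, Nat.cast_sub hp.one_le]
  push_cast
  ring

theorem primitiveProportion_eq_prod {n : ℕ} (hn : n ≠ 0) :
    primitiveProportion n = ∏ p ∈ n.primeFactors,
      ((primitiveCount (p ^ n.factorization p) : ℝ) /
        ((p ^ n.factorization p).totient : ℝ)) := by
  have : NeZero n := ⟨hn⟩
  have h1 := isMultiplicative_primitiveCount.multiplicative_factorization _ hn
  have h2 : (n.totient : ℤ) = ∏ p ∈ n.primeFactors, ((p ^ n.factorization p).totient : ℤ) :=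
    isMultiplicative_totientArith.multiplicative_factorization _ hn
  rw [primitiveCount_apply hn] at h1
  rw [primitiveProportion, DirichletCharacter.card_eq_totient_of_hasEnoughRootsOfUnity,
    Finset.prod_div_distrib]
  congr 1
  · exact_mod_cast h1
  · exact_mod_cast h2

/-! ### Local factors and their minimum -/

/-- The smallest proportion of primitive characters among the prime powers `p ^ a`, `p ^ a ≠ 2`. -/
noncomputable def minLocalProportion (p : ℕ) : ℝ :=
  if p = 2 then 1 / 2 else ((p : ℝ) - 2) / ((p : ℝ) - 1)

theorem localProportion_of_two_le {p a : ℕ} (hp : p.Prime) :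
    (primitiveCount (p ^ (a + 2)) : ℝ) / ((p ^ (a + 2)).totient : ℝ) =
      ((p : ℝ) - 1) / p := by
  have hp1 : (1 : ℝ) < p := by exact_mod_cast hp.one_lt
  have hp2 : (p : ℝ) - 1 ≠ 0 := by linarith
  have hp3 : (p : ℝ) ≠ 0 := by linarith
  rw [primitiveCount_prime_pow hp (a + 1), Nat.totient_prime_pow_succ hp,
    Nat.totient_prime_pow_succ hp]
  push_cast [Nat.cast_sub hp.one_le]
  field_simp
  ring

theorem localProportion_prime {p : ℕ} (hp : p.Prime) :
    (primitiveCount p : ℝ) / (p.totient : ℝ) = ((p : ℝ) - 2) / ((p : ℝ) - 1) := by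
  rw [primitiveCount_prime hp, Nat.totient_prime hp]
  push_cast [Nat.cast_sub hp.one_le]
  rfl

theorem minLocalProportion_pos {p : ℕ} (hp : p.Prime) : 0 < minLocalProportion p := by
  unfold minLocalProportion
  split_ifs with h
  · norm_num
  · have : (2 : ℝ) < p := by exact_mod_cast lt_of_le_of_ne hp.two_le (Ne.symm h)
    exact div_pos (by linarith) (by linarith)

/-- For odd primes the value is 1 - 1/(p-1), increasing in p; at 3 it equals the value 1/2 taken at
2. -/
theorem minLocalProportion_mono {p q : ℕ} (hp : p.Prime) (hq : q.Prime) (hpq : p ≤ q) :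
    minLocalProportion p ≤ minLocalProportion q := by
  unfold minLocalProportion
  have hp2 := hp.two_le
  split_ifs with h h' h'
  · rfl
  · have : (3 : ℝ) ≤ q := by exact_mod_cast lt_of_le_of_ne hq.two_le (Ne.symm h')
    rw [div_le_div_iff₀ (by norm_num) (by linarith)]
    linarith
  · omega
  · have h1 : (3 : ℝ) ≤ p := by exact_mod_cast lt_of_le_of_ne hp.two_le (Ne.symm h)
    have h2 : (p : ℝ) ≤ q := by exact_mod_cast hpq
    rw [div_le_div_iff₀ (by linarith) (by linarith)]
    nlinarith

/-- For odd p the exponent 1 is the worst, since p(p-2) ≤ (p-1)². For p = 2 every exponent from 2 on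
gives 1/2. -/
theorem minLocalProportion_le {p a : ℕ} (hp : p.Prime) (ha : a ≠ 0) (h : p = 2 → a ≠ 1) :
    minLocalProportion p ≤ (primitiveCount (p ^ a) : ℝ) / ((p ^ a).totient : ℝ) := by
  obtain _ | _ | a := a
  · exact absurd rfl ha
  · rw [zero_add, pow_one, localProportion_prime hp, minLocalProportion,
      if_neg fun h2 => h h2 rfl]
  · rw [localProportion_of_two_le hp, minLocalProportion]
    split_ifs with h2
    · subst h2; norm_num
    · have : (2 : ℝ) < p := by exact_mod_cast lt_of_le_of_ne hp.two_le (Ne.symm h2)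
      rw [div_le_div_iff₀ (by linarith) (by linarith)]
      nlinarith

theorem factorization_two_ne_one {n : ℕ} (hn : ¬ n ≡ 2 [MOD 4]) : n.factorization 2 ≠ 1 := by
  intro h
  have hn0 : n ≠ 0 := by rintro rfl; simp at h
  have h1 : 2 ∣ n := by
    have := (Nat.Prime.pow_dvd_iff_le_factorization Nat.prime_two hn0 (k := 1)).mpr h.ge
    simpa using this
  have h2 : ¬ 4 ∣ n := fun h4 => by
    have := (Nat.Prime.pow_dvd_iff_le_factorization Nat.prime_two hn0 (k := 2)).mp (by simpa using h4)
    omega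
  apply hn
  unfold Nat.ModEq
  omega

theorem prod_minLocalProportion_le {n : ℕ} (hn0 : n ≠ 0) (hn : ¬ n ≡ 2 [MOD 4]) :
    ∏ p ∈ n.primeFactors, minLocalProportion p ≤ primitiveProportion n := by
  rw [primitiveProportion_eq_prod hn0]
  refine Finset.prod_le_prod (fun p hp => (minLocalProportion_pos (Nat.prime_of_mem_primeFactors hp)).le)
    fun p hp => minLocalProportion_le (Nat.prime_of_mem_primeFactors hp) ?_ ?_
  · rw [← Finsupp.mem_support_iff, Nat.support_factorization]
    exact hp
  · rintro rfl
    exact factorization_two_ne_one hn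

/-! ### Minimality of the first primes and of 2n_k -/

theorem nth_prime_le_max_of_card {S : Finset ℕ} (hS : ∀ p ∈ S, p.Prime) {k : ℕ}
    (hk : S.card = k + 1) {m : ℕ} (hm : ∀ p ∈ S, p ≤ m) : Nat.nth Nat.Prime k ≤ m := by
  have hsub : S ⊆ (Finset.range (m + 1)).filter Nat.Prime := fun p hp =>
    Finset.mem_filter.mpr ⟨Finset.mem_range.mpr (Nat.lt_succ_of_le (hm p hp)), hS p hp⟩
  have hc : k < Nat.count Nat.Prime (m + 1) := by
    rw [Nat.count_eq_card_filter_range, ← Nat.succ_le_iff]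
    exact hk.symm.le.trans (Finset.card_le_card hsub)
  exact Nat.lt_succ_iff.mp (Nat.nth_lt_of_lt_count hc)

/-- Among sets of `k` primes, the first `k` primes minimise `∏ g p` for `g` monotone. -/
theorem prod_nth_prime_le_prod {g : ℕ → ℝ} (hpos : ∀ p, p.Prime → 0 ≤ g p)
    (hmono : ∀ p q, p.Prime → q.Prime → p ≤ q → g p ≤ g q) (k : ℕ) (S : Finset ℕ)
    (hS : ∀ p ∈ S, p.Prime) (hk : S.card = k) :
    ∏ i ∈ Finset.range k, g (Nat.nth Nat.Prime i) ≤ ∏ p ∈ S, g p := by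
  induction k generalizing S with
  | zero => simp [Finset.card_eq_zero.mp hk]
  | succ k ih =>
    have hne : S.Nonempty := Finset.card_pos.mp (by omega)
    have hmem := S.max'_mem hne
    have hle : Nat.nth Nat.Prime k ≤ S.max' hne :=
      nth_prime_le_max_of_card hS hk fun p hp => S.le_max' p hp
    -- The largest element of S is matched with the last of the first k+1 primes; the rest is the
    -- induction hypothesis.
    rw [Finset.prod_range_succ, ← Finset.prod_erase_mul S g hmem]
    refine mul_le_mul (ih _ (fun p hp => hS p (Finset.mem_of_mem_erase hp)) ?_)
      (hmono _ _ (Nat.prime_nth_prime k) (hS _ hmem) hle) (hpos _ (Nat.prime_nth_prime k))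
      (Finset.prod_nonneg fun p hp => hpos p (hS p (Finset.mem_of_mem_erase hp)))
    rw [Finset.card_erase_of_mem hmem, hk, Nat.add_sub_cancel]

theorem nth_prime_injective : Function.Injective (Nat.nth Nat.Prime) :=
  Nat.nth_injective Nat.infinite_setOfPred_prime

theorem primeProd_eq_prod_image (k : ℕ) :
    primeProd k = ∏ p ∈ (Finset.range k).image (Nat.nth Nat.Prime), p := by
  rw [Finset.prod_image fun a _ b _ h => nth_prime_injective h]
  rfl

theorem primeProd_pos (k : ℕ) : 0 < primeProd k :=
  Finset.prod_pos fun i _ => (Nat.prime_nth_prime i).pos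

theorem primeFactors_primeProd (k : ℕ) :
    (primeProd k).primeFactors = (Finset.range k).image (Nat.nth Nat.Prime) := by
  rw [primeProd_eq_prod_image]
  refine Nat.primeFactors_prod fun p hp => ?_
  obtain ⟨i, -, rfl⟩ := Finset.mem_image.mp hp
  exact Nat.prime_nth_prime i

theorem two_mem_primeFactors_primeProd {k : ℕ} (hk : 0 < k) : 2 ∈ (primeProd k).primeFactors := by
  rw [primeFactors_primeProd]
  exact Finset.mem_image.mpr ⟨0, Finset.mem_range.mpr hk, Nat.nth_prime_zero_eq_two⟩

theorem primeFactors_two_mul_primeProd {k : ℕ} (hk : 0 < k) :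
    (2 * primeProd k).primeFactors = (Finset.range k).image (Nat.nth Nat.Prime) := by
  rw [Nat.primeFactors_mul two_ne_zero (primeProd_pos k).ne', Nat.prime_two.primeFactors,
    ← primeFactors_primeProd k]
  exact Finset.union_eq_right.mpr
    (Finset.singleton_subset_iff.mpr (two_mem_primeFactors_primeProd hk))

theorem squarefree_primeProd (k : ℕ) : Squarefree (primeProd k) := by
  rw [primeProd_eq_prod_image]
  refine Finset.squarefree_prod_of_pairwise_isCoprime ?_ ?_
  · intro p hp q hq hpq
    obtain ⟨i, -, rfl⟩ := Finset.mem_image.mp hp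
    obtain ⟨j, -, rfl⟩ := Finset.mem_image.mp hq
    exact Nat.coprime_iff_isRelPrime.mp
      ((Nat.coprime_primes (Nat.prime_nth_prime i) (Nat.prime_nth_prime j)).mpr hpq)
  · intro p hp
    obtain ⟨i, -, rfl⟩ := Finset.mem_image.mp hp
    exact (Nat.prime_nth_prime i).prime.squarefree

theorem two_mul_primeProd_not_modEq {k : ℕ} (hk : 0 < k) : ¬ 2 * primeProd k ≡ 2 [MOD 4] := by
  have h := Nat.dvd_of_mem_primeFactors (two_mem_primeFactors_primeProd hk)
  unfold Nat.ModEq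
  omega

theorem cardDistinctFactors_eq_card_primeFactors (n : ℕ) :
    ArithmeticFunction.cardDistinctFactors n = n.primeFactors.card := by
  rw [ArithmeticFunction.cardDistinctFactors_apply]
  rfl

theorem cardDistinctFactors_two_mul_primeProd {k : ℕ} (hk : 0 < k) :
    ArithmeticFunction.cardDistinctFactors (2 * primeProd k) = k := by
  rw [cardDistinctFactors_eq_card_primeFactors, primeFactors_two_mul_primeProd hk,
    Finset.card_image_of_injective _ nth_prime_injective, Finset.card_range]

theorem primitiveProportion_two_mul_primeProd {k : ℕ} (hk : 0 < k) :
    primitiveProportion (2 * primeProd k) =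
      ∏ i ∈ Finset.range k, minLocalProportion (Nat.nth Nat.Prime i) := by
  have h0 := (primeProd_pos k).ne'
  rw [primitiveProportion_eq_prod (mul_ne_zero two_ne_zero h0), primeFactors_two_mul_primeProd hk,
    Finset.prod_image fun a _ b _ h => nth_prime_injective h]
  refine Finset.prod_congr rfl fun i hi => ?_
  have hp := Nat.prime_nth_prime i
  have hmem : Nat.nth Nat.Prime i ∈ (primeProd k).primeFactors := by
    rw [primeFactors_primeProd]
    exact Finset.mem_image_of_mem _ hi
  have h1 : (primeProd k).factorization (Nat.nth Nat.Prime i) = 1 := by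
    refine le_antisymm ((squarefree_primeProd k).natFactorization_le_one _) ?_
    exact hp.factorization_pos_of_dvd h0 (Nat.dvd_of_mem_primeFactors hmem)
  rw [Nat.factorization_mul two_ne_zero h0, Finsupp.add_apply, h1, Nat.prime_two.factorization]
  by_cases h2 : Nat.nth Nat.Prime i = 2
  · rw [h2, Finsupp.single_eq_same, localProportion_of_two_le Nat.prime_two, minLocalProportion,
      if_pos rfl]
    norm_num
  · rw [Finsupp.single_eq_of_ne h2, zero_add, pow_one, localProportion_prime hp,
      minLocalProportion, if_neg h2]

theorem prod_nth_minLocalProportion_le {n : ℕ} (hn0 : n ≠ 0) (hn : ¬ n ≡ 2 [MOD 4]) :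
    ∏ i ∈ Finset.range n.primeFactors.card, minLocalProportion (Nat.nth Nat.Prime i) ≤
      primitiveProportion n :=
  (prod_nth_prime_le_prod (fun _ hp => (minLocalProportion_pos hp).le)
    (fun _ _ => minLocalProportion_mono) _ _
    (fun _ => Nat.prime_of_mem_primeFactors) rfl).trans (prod_minLocalProportion_le hn0 hn)

theorem primeProd_le_prod {S : Finset ℕ} (hS : ∀ p ∈ S, p.Prime) :
    primeProd S.card ≤ ∏ p ∈ S, p := by
  have := prod_nth_prime_le_prod (g := fun p => (p : ℝ)) (fun _ _ => Nat.cast_nonneg _)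
    (fun _ _ _ _ h => Nat.cast_le.mpr h) S.card S hS rfl
  rw [← Nat.cast_le (α := ℝ), primeProd]
  push_cast
  exact this

/-- If n is even then 4 ∣ n, so n/2 has the same primes and is at least n_k. If n is odd, adjoining
2 gives k+1 primes with n_{k+1} ≤ 2n, and n_{k+1} ≥ 5n_k because k > 1. For k = 1 the bound fails at
n = 3. -/
theorem two_mul_primeProd_le {n : ℕ} (hn0 : n ≠ 0) (hn : ¬ n ≡ 2 [MOD 4])
    (hk : 1 < n.primeFactors.card) : 2 * primeProd n.primeFactors.card ≤ n := by
  have hS : ∀ p ∈ n.primeFactors, p.Prime := fun _ => Nat.prime_of_mem_primeFactors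
  rcases Nat.even_or_odd' n with ⟨m, hm | hm⟩
  · have hm2 : 2 ∣ m := by
      unfold Nat.ModEq at hn
      omega
    have hm0 : m ≠ 0 := by omega
    have hpf : n.primeFactors = m.primeFactors := by
      rw [hm, Nat.primeFactors_mul two_ne_zero hm0, Nat.prime_two.primeFactors]
      exact Finset.union_eq_right.mpr (Finset.singleton_subset_iff.mpr
        (Nat.mem_primeFactors.mpr ⟨Nat.prime_two, hm2, hm0⟩))
    calc 2 * primeProd n.primeFactors.card ≤ 2 * ∏ p ∈ n.primeFactors, p :=
          Nat.mul_le_mul_left 2 (primeProd_le_prod hS)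
      _ ≤ 2 * m := Nat.mul_le_mul_left 2
          (hpf ▸ Nat.le_of_dvd (Nat.pos_of_ne_zero hm0) (Nat.prod_primeFactors_dvd m))
      _ = n := hm.symm
  · have h2 : 2 ∉ n.primeFactors := fun h => by
      have := Nat.dvd_of_mem_primeFactors h
      omega
    have h1 := primeProd_le_prod (S := insert 2 n.primeFactors) fun p hp => by
      rcases Finset.mem_insert.mp hp with rfl | hp
      · exact Nat.prime_two
      · exact hS p hp
    rw [Finset.card_insert_of_notMem h2, Finset.prod_insert h2] at h1
    have h3 : 5 ≤ Nat.nth Nat.Prime n.primeFactors.card := by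
      rw [← Nat.nth_prime_two_eq_five]
      exact Nat.nth_monotone Nat.infinite_setOfPred_prime hk
    have h4 : primeProd (n.primeFactors.card + 1) =
        primeProd n.primeFactors.card * Nat.nth Nat.Prime n.primeFactors.card :=
      Finset.prod_range_succ _ _
    have h5 : ∏ p ∈ n.primeFactors, p ≤ n :=
      Nat.le_of_dvd (Nat.pos_of_ne_zero hn0) (Nat.prod_primeFactors_dvd n)
    rw [h4] at h1
    have h6 := Nat.mul_le_mul_left (primeProd n.primeFactors.card) h3
    omega

theorem twelve_le_two_mul_primeProd {k : ℕ} (hk : 1 < k) : 12 ≤ 2 * primeProd k := by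
  have h : primeProd 2 ∣ primeProd k :=
    Finset.prod_dvd_prod_of_subset _ _ _ (Finset.range_mono hk)
  have h2 : primeProd 2 = 6 := by
    simp [primeProd, Finset.prod_range_succ, Nat.nth_prime_zero_eq_two,
      Nat.nth_prime_one_eq_three]
  have := Nat.le_of_dvd (primeProd_pos k) h
  omega

theorem primitiveProportion_mul_loglog_le {k : ℕ} (hk : 1 < k) {n : ℕ} (hn : ¬ n ≡ 2 [MOD 4])
    (hω : ArithmeticFunction.cardDistinctFactors n = k) :
    primitiveProportion (2 * primeProd k) * Real.log (Real.log ((2 * primeProd k : ℕ) : ℝ))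
      ≤ primitiveProportion n * Real.log (Real.log (n : ℝ)) := by
  have hn0 : n ≠ 0 := by
    rintro rfl
    simp at hω
    omega
  rw [cardDistinctFactors_eq_card_primeFactors] at hω
  have h1 : primitiveProportion (2 * primeProd k) ≤ primitiveProportion n := by
    rw [primitiveProportion_two_mul_primeProd (by omega), ← hω]
    exact prod_nth_minLocalProportion_le hn0 hn
  have h2 : 2 * primeProd k ≤ n := hω ▸ two_mul_primeProd_le hn0 hn (by omega)
  have h12 : (12 : ℝ) ≤ ((2 * primeProd k : ℕ) : ℝ) := by
    exact_mod_cast twelve_le_two_mul_primeProd hk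
  have h2' : ((2 * primeProd k : ℕ) : ℝ) ≤ n := by exact_mod_cast h2
  -- 12 > e makes log log(2n_k) nonnegative, as multiplying the two inequalities requires.
  have hlog : 1 ≤ Real.log ((2 * primeProd k : ℕ) : ℝ) := by
    rw [Real.le_log_iff_exp_le (by linarith)]
    linarith [Real.exp_one_lt_d9]
  refine mul_le_mul h1 (Real.log_le_log (by linarith) (Real.log_le_log (by linarith) h2'))
    (Real.log_nonneg hlog) ?_
  exact div_nonneg (Nat.cast_nonneg _) (Nat.cast_nonneg _)

/-! ### Mertens' first theorem -/

theorem log_factorial_eq_sum_primesLE (N : ℕ) :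
    Real.log (N.factorial : ℝ) =
      ∑ p ∈ Nat.primesLE N, (N.factorial.factorization p : ℝ) * Real.log p := by
  have h : N.factorial.primeFactors ⊆ Nat.primesLE N := fun p hp => by
    rw [Nat.mem_primesLE]
    have hp' := Nat.prime_of_mem_primeFactors hp
    exact ⟨(hp'.dvd_factorial).mp (Nat.dvd_of_mem_primeFactors hp), hp'⟩
  rw [Real.log_nat_eq_sum_factorization, Finsupp.sum]
  refine Finset.sum_subset h fun p _ hp => ?_
  rw [Finsupp.notMem_support_iff.mp hp]
  simp

theorem le_factorization_factorial {p N : ℕ} (hp : p.Prime) :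
    (N : ℝ) / p - 1 ≤ (N.factorial.factorization p : ℝ) := by
  have h1 : N / p ≤ N.factorial.factorization p := by
    have h := Nat.factorization_factorial_mul hp (n := N / p)
    have h2 := (Nat.factorization_le_iff_dvd (Nat.factorial_ne_zero _)
      (Nat.factorial_ne_zero _)).mpr (Nat.factorial_dvd_factorial (Nat.mul_div_le N p)) p
    omega
  have h2 : (N : ℝ) / p < ((N / p : ℕ) : ℝ) + 1 := by
    rw [div_lt_iff₀ (by exact_mod_cast hp.pos)]
    have h := Nat.lt_mul_div_succ N hp.pos
    rw [mul_comm] at h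
    exact_mod_cast h
  have h3 : ((N / p : ℕ) : ℝ) ≤ (N.factorial.factorization p : ℝ) := by exact_mod_cast h1
  linarith

theorem factorization_factorial_le {p N : ℕ} (hp : p.Prime) :
    (N.factorial.factorization p : ℝ) ≤ (N : ℝ) / ((p : ℝ) - 1) := by
  have h := (Nat.cast_le (α := ℝ)).mpr (Nat.factorization_factorial_le_div_pred hp N)
  have h2 := Nat.cast_div_le (α := ℝ) (m := N) (n := p - 1)
  rw [Nat.cast_sub hp.one_le, Nat.cast_one] at h2
  exact h.trans h2

theorem log_div_mul_sub_one_nonneg (n : ℕ) :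
    0 ≤ Real.log n / ((n : ℝ) * ((n : ℝ) - 1)) := by
  rcases n with _ | n
  · simp
  · push_cast
    exact div_nonneg (Real.log_nonneg (by linarith [Nat.cast_nonneg (α := ℝ) n]))
      (mul_nonneg (by positivity) (by linarith [Nat.cast_nonneg (α := ℝ) n]))

theorem summable_log_div_mul_sub_one :
    Summable fun n : ℕ => Real.log n / ((n : ℝ) * ((n : ℝ) - 1)) := by
  have h0 : Summable fun n : ℕ => 4 * (1 / (n : ℝ) ^ (3 / 2 : ℝ)) :=
    (Real.summable_one_div_nat_rpow.mpr (by norm_num)).mul_left 4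
  refine Summable.of_nonneg_of_le log_div_mul_sub_one_nonneg (fun n => ?_) h0
  rcases lt_or_ge n 2 with hn | hn
  · interval_cases n <;> norm_num
  · have hn' : (2 : ℝ) ≤ n := by exact_mod_cast hn
    -- log n ≤ 2√n and n ≤ 2(n-1) yield the constant 4.
    have h1 := Real.log_le_rpow_div (x := (n : ℝ)) (by linarith) (ε := 1 / 2) (by norm_num)
    have h2 : (n : ℝ) ^ (3 / 2 : ℝ) * (n : ℝ) ^ (1 / 2 : ℝ) = (n : ℝ) ^ 2 := by
      rw [← Real.rpow_add (by linarith), ← Real.rpow_natCast]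
      norm_num
    have h3 : 0 < (n : ℝ) ^ (3 / 2 : ℝ) := Real.rpow_pos_of_pos (by linarith) _
    rw [mul_one_div, div_le_div_iff₀ (by nlinarith) h3]
    calc Real.log n * (n : ℝ) ^ (3 / 2 : ℝ)
        ≤ ((n : ℝ) ^ (1 / 2 : ℝ) / (1 / 2)) * (n : ℝ) ^ (3 / 2 : ℝ) :=
          mul_le_mul_of_nonneg_right h1 h3.le
      _ = 2 * (n : ℝ) ^ 2 := by rw [← h2]; ring
      _ ≤ 4 * ((n : ℝ) * ((n : ℝ) - 1)) := by nlinarith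

/-- Mertens' first theorem. -/
theorem exists_abs_sum_log_div_sub_log_le :
    ∃ C : ℝ, ∀ N : ℕ, |∑ p ∈ Nat.primesLE N, Real.log p / p - Real.log N| ≤ C := by
  set T := ∑' n : ℕ, Real.log n / ((n : ℝ) * ((n : ℝ) - 1)) with hT
  have hT0 : 0 ≤ T := tsum_nonneg log_div_mul_sub_one_nonneg
  have hlog4 : 0 ≤ Real.log 4 := Real.log_nonneg (by norm_num)
  refine ⟨T + 1 + Real.log 4, fun N => ?_⟩
  rcases Nat.eq_zero_or_pos N with rfl | hN
  · simp [Nat.primesLE]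
    positivity
  have hN' : (0 : ℝ) < N := by exact_mod_cast hN
  set S := ∑ p ∈ Nat.primesLE N, Real.log p / p with hS
  -- The exponent of p in N! is at least N/p - 1; the loss is θ(N) ≤ N log 4, and N! ≤ N^N.
  have hupper : N * S - Real.log 4 * N ≤ N * Real.log N := by
    have hfac : Real.log (N.factorial : ℝ) ≤ N * Real.log N := by
      rw [← Real.log_pow]
      exact Real.log_le_log (by exact_mod_cast N.factorial_pos)
        (by exact_mod_cast Nat.factorial_le_pow N)
    have htheta := Chebyshev.theta_le_log4_mul_x (x := (N : ℝ)) hN'.le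
    rw [Chebyshev.theta_eq_sum_primesLE_log] at htheta
    have h : N * S - ∑ p ∈ Nat.primesLE N, Real.log p ≤ Real.log (N.factorial : ℝ) := by
      rw [log_factorial_eq_sum_primesLE, hS, Finset.mul_sum, ← Finset.sum_sub_distrib]
      refine Finset.sum_le_sum fun p hp => ?_
      have hp' := (Nat.mem_primesLE.mp hp).2
      calc (N : ℝ) * (Real.log p / p) - Real.log p = ((N : ℝ) / p - 1) * Real.log p := by ring
        _ ≤ _ := mul_le_mul_of_nonneg_right (le_factorization_factorial hp')
            (Real.log_natCast_nonneg p)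
    linarith
  -- The exponent of p is at most N/(p-1), with 1/(p-1) = 1/p + 1/(p(p-1)); the second part sums to
  -- at most T. The bound N! ≥ (N/e)^N comes from N^N/N! ≤ e^N.
  have hlower : N * Real.log N - N ≤ N * (S + T) := by
    have hfac : N * Real.log N - N ≤ Real.log (N.factorial : ℝ) := by
      have h := Real.pow_div_factorial_le_exp _ hN'.le N
      rw [div_le_iff₀ (by positivity)] at h
      have h1 := Real.log_le_log (by positivity) h
      rw [Real.log_mul (Real.exp_ne_zero _) (by positivity), Real.log_exp, Real.log_pow] at h1
      linarith
    have h : Real.log (N.factorial : ℝ) ≤ N * (S + T) := by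
      rw [log_factorial_eq_sum_primesLE]
      have h1 : ∑ p ∈ Nat.primesLE N, Real.log p / ((p : ℝ) * ((p : ℝ) - 1)) ≤ T :=
        summable_log_div_mul_sub_one.sum_le_tsum _ fun n _ => log_div_mul_sub_one_nonneg n
      refine le_trans ?_ (mul_le_mul_of_nonneg_left (add_le_add_right h1 S) hN'.le)
      rw [hS, ← Finset.sum_add_distrib, Finset.mul_sum]
      refine Finset.sum_le_sum fun p hp => ?_
      have hp' := (Nat.mem_primesLE.mp hp).2
      have hp1 : (1 : ℝ) < p := by exact_mod_cast hp'.one_lt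
      have hp2 : (p : ℝ) - 1 ≠ 0 := by linarith
      have hp3 : (p : ℝ) ≠ 0 := by linarith
      refine (mul_le_mul_of_nonneg_right (factorization_factorial_le hp')
        (Real.log_natCast_nonneg p)).trans_eq ?_
      field_simp
      ring
    linarith
  rw [abs_le]
  constructor
  · have : N * (Real.log N - 1) ≤ N * (S + T) := by linarith
    have := le_of_mul_le_mul_left this hN'
    linarith
  · have : N * (S - Real.log 4) ≤ N * Real.log N := by linarith
    have := le_of_mul_le_mul_left this hN'
    linarith

/-! ### Mertens' second theorem -/

theorem neg_log_one_sub_sub_self_bounds {x : ℝ} (h1 : x ≤ 1 / 2) :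
    0 ≤ -Real.log (1 - x) - x ∧ -Real.log (1 - x) - x ≤ 2 * x ^ 2 := by
  have hpos : 0 < 1 - x := by linarith
  constructor
  · linarith [Real.log_le_sub_one_of_pos hpos]
  · have h := Real.one_sub_inv_le_log_of_pos hpos
    have h2 : (1 - x)⁻¹ ≤ 1 + x + 2 * x ^ 2 := by
      rw [inv_le_iff_one_le_mul₀ hpos]
      nlinarith [mul_nonneg (sq_nonneg x) (by linarith : (0 : ℝ) ≤ 1 - 2 * x)]
    linarith

/-- `p ↦ -log (1 - 1 / p)` on the primes, extended by zero. -/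
noncomputable def primeLogWeight (n : ℕ) : ℝ :=
  if n.Prime then -Real.log (1 - 1 / (n : ℝ)) else 0

theorem one_div_prime_le_half {p : ℕ} (hp : p.Prime) : 1 / (p : ℝ) ≤ 1 / 2 :=
  one_div_le_one_div_of_le (by norm_num) (by exact_mod_cast hp.two_le)

theorem primeLogWeight_nonneg (n : ℕ) : 0 ≤ primeLogWeight n := by
  unfold primeLogWeight
  split_ifs with h
  · have := (neg_log_one_sub_sub_self_bounds (one_div_prime_le_half h)).1
    have : 0 ≤ 1 / (n : ℝ) := by positivity
    linarith
  · rfl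

theorem summable_two_mul_inv_sq : Summable fun n : ℕ => 2 * (1 / (n : ℝ)) ^ 2 := by
  have := (Real.summable_one_div_nat_pow.mpr one_lt_two).mul_left 2
  exact this.congr fun n => by rw [one_div_pow]

/-- The increments of `log log`, compared with those of `log` divided by `log`. -/
theorem summable_log_increment_div_log_sub :
    Summable fun n : ℕ => (Real.log (max n 2 : ℕ))⁻¹ *
        (Real.log ((n + 1 : ℕ) : ℝ) - Real.log n) -
      (Real.log (Real.log ((n + 1 : ℕ) : ℝ)) - Real.log (Real.log n)) := by
  rw [← summable_nat_add_iff 2]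
  have h2 : 0 < Real.log 2 := Real.log_pos (by norm_num)
  have h0 : Summable fun n : ℕ => (Real.log 2)⁻¹ ^ 2 * (1 / ((n + 2 : ℕ) : ℝ) ^ 2) :=
    ((summable_nat_add_iff 2).mpr (Real.summable_one_div_nat_pow.mpr one_lt_two)).mul_left _
  -- With y the first product, 1 + y = log(x+1)/log x, so the term is y - log(1+y), which lies
  -- between 0 and y² = O(1/x²).
  have key : ∀ n : ℕ, ∃ y : ℝ, 0 ≤ y ∧ y ≤ (Real.log 2)⁻¹ * (1 / ((n + 2 : ℕ) : ℝ)) ∧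
      (Real.log (max (n + 2) 2 : ℕ))⁻¹ *
        (Real.log ((n + 2 + 1 : ℕ) : ℝ) - Real.log ((n + 2 : ℕ) : ℝ)) -
      (Real.log (Real.log ((n + 2 + 1 : ℕ) : ℝ)) - Real.log (Real.log ((n + 2 : ℕ) : ℝ)))
        = y - Real.log (1 + y) := by
    intro n
    have hn : (2 : ℝ) ≤ ((n + 2 : ℕ) : ℝ) := by exact_mod_cast Nat.le_add_left 2 n
    have hn1 : ((n + 2 + 1 : ℕ) : ℝ) = ((n + 2 : ℕ) : ℝ) + 1 := by push_cast; ring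
    rw [max_eq_left (Nat.le_add_left 2 n), hn1]
    set x : ℝ := ((n + 2 : ℕ) : ℝ)
    have hL : Real.log 2 ≤ Real.log x := Real.log_le_log (by norm_num) hn
    have hL0 : 0 < Real.log x := h2.trans_le hL
    have hd0 : 0 ≤ Real.log (x + 1) - Real.log x :=
      sub_nonneg.mpr (Real.log_le_log (by linarith) (by linarith))
    have hd1 : Real.log (x + 1) - Real.log x ≤ 1 / x := by
      rw [← Real.log_div (by linarith) (by linarith)]
      refine (Real.log_le_sub_one_of_pos (by positivity)).trans_eq ?_
      field_simp
      ring
    refine ⟨(Real.log x)⁻¹ * (Real.log (x + 1) - Real.log x), by positivity,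
      mul_le_mul (inv_anti₀ h2 hL) hd1 hd0 (by positivity), ?_⟩
    rw [← Real.log_div (by linarith) hL0.ne']
    congr 2
    field_simp
    ring
  refine Summable.of_nonneg_of_le (fun n => ?_) (fun n => ?_) h0
  · obtain ⟨y, hy0, -, hy⟩ := key n
    rw [hy]
    have := Real.log_le_sub_one_of_pos (x := 1 + y) (by linarith)
    linarith
  · obtain ⟨y, hy0, hy1, hy⟩ := key n
    rw [hy]
    have h := Real.one_sub_inv_le_log_of_pos (x := 1 + y) (by linarith)
    have h3 : 1 - (1 + y)⁻¹ ≥ y - y ^ 2 := by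
      have : (1 + y)⁻¹ ≤ 1 - y + y ^ 2 := by
        rw [inv_le_iff_one_le_mul₀ (by linarith)]
        nlinarith [pow_nonneg hy0 3]
      linarith
    calc y - Real.log (1 + y) ≤ y ^ 2 := by linarith
      _ ≤ ((Real.log 2)⁻¹ * (1 / ((n + 2 : ℕ) : ℝ))) ^ 2 := pow_le_pow_left₀ hy0 hy1 2
      _ = _ := by rw [mul_pow, one_div_pow]

/-- Dirichlet's test: Mertens' first theorem bounds the partial sums, and the weights decrease to 0.
The `max` keeps them monotone at n = 0, 1, where the inverse of log would be 0. -/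
theorem cauchySeq_sum_prime_sub_log_increment :
    CauchySeq fun N : ℕ => ∑ n ∈ Finset.range N, (Real.log (max n 2 : ℕ))⁻¹ *
      ((if n.Prime then Real.log n / n else 0) -
        (Real.log ((n + 1 : ℕ) : ℝ) - Real.log n)) := by
  obtain ⟨C, hC⟩ := exists_abs_sum_log_div_sub_log_le
  have hanti : Antitone fun n : ℕ => (Real.log (max n 2 : ℕ))⁻¹ := fun a b hab => by
    have h2 : (2 : ℝ) ≤ (max a 2 : ℕ) := by exact_mod_cast le_max_right a 2
    refine inv_anti₀ (Real.log_pos (by linarith)) (Real.log_le_log (by linarith) ?_)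
    exact_mod_cast max_le_max hab le_rfl
  have hzero : Tendsto (fun n : ℕ => (Real.log (max n 2 : ℕ))⁻¹) atTop (𝓝 0) := by
    refine (Real.tendsto_log_atTop.comp (tendsto_natCast_atTop_atTop.comp ?_)).inv_tendsto_atTop
    exact tendsto_atTop_mono (fun n => le_max_left n 2) tendsto_id
  -- The extra 1 absorbs log(N+1) - log N: the increments telescope one step beyond the primes up to
  -- N.
  refine hanti.cauchySeq_series_mul_of_tendsto_zero_of_bounded hzero (b := C + 1) fun N => ?_
  rw [Finset.sum_sub_distrib, Finset.sum_range_sub (fun n : ℕ => Real.log n), ← Finset.sum_filter]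
  rcases N with _ | N
  · have := (abs_nonneg _).trans (hC 0)
    simp
    linarith
  have hset : (Finset.range (N + 1)).filter Nat.Prime = Nat.primesLE N := by
    ext p
    simp [Nat.mem_primesLE]
  have h1 := abs_le.mp (hC N)
  have h2 : 0 ≤ Real.log ((N + 1 : ℕ) : ℝ) - Real.log N ∧
      Real.log ((N + 1 : ℕ) : ℝ) - Real.log N ≤ 1 := by
    rcases Nat.eq_zero_or_pos N with rfl | hN
    · simp
    have hN' : (1 : ℝ) ≤ N := by exact_mod_cast hN
    push_cast
    constructor
    · exact sub_nonneg.mpr (Real.log_le_log (by linarith) (by linarith))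
    · rw [← Real.log_div (by linarith) (by linarith)]
      refine (Real.log_le_sub_one_of_pos (by positivity)).trans ?_
      rw [sub_le_iff_le_add, div_le_iff₀ (by linarith)]
      linarith
  rw [hset, Real.norm_eq_abs, Nat.cast_zero, Real.log_zero, sub_zero, abs_le]
  constructor <;> linarith [h1.1, h1.2, h2.1, h2.2]

/-- Mertens' second theorem, without the value of the constant. -/
theorem exists_tendsto_sum_primeLogWeight_sub_log_log :
    ∃ l : ℝ, Tendsto (fun N : ℕ => ∑ n ∈ Finset.range N, primeLogWeight n -
      Real.log (Real.log N)) atTop (𝓝 l) := by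
  obtain ⟨l₁, h₁⟩ := cauchySeq_tendsto_of_complete cauchySeq_sum_prime_sub_log_increment
  have h₂ := summable_log_increment_div_log_sub.hasSum.tendsto_sum_nat
  have hs : Summable fun n : ℕ => primeLogWeight n - if n.Prime then 1 / (n : ℝ) else 0 := by
    refine Summable.of_nonneg_of_le (fun n => ?_) (fun n => ?_) summable_two_mul_inv_sq
    all_goals
      unfold primeLogWeight
      split_ifs with h
      · have := neg_log_one_sub_sub_self_bounds (one_div_prime_le_half h)
        first | exact this.1 | exact this.2
      · rw [sub_zero]
        try positivity
  have h₃ := hs.hasSum.tendsto_sum_nat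
  -- Three comparisons are added: log p/p with the increments of log, these with the increments of
  -- log log, and -log(1-1/p) with 1/p.
  refine ⟨_, ((h₁.add h₂).add h₃).congr fun N => ?_⟩
  have htel := Finset.sum_range_sub (fun n : ℕ => Real.log (Real.log n)) N
  rw [Nat.cast_zero, Real.log_zero, Real.log_zero, sub_zero] at htel
  rw [← htel, ← Finset.sum_add_distrib, ← Finset.sum_add_distrib, ← Finset.sum_sub_distrib]
  refine Finset.sum_congr rfl fun n _ => ?_
  have hp : (Real.log (max n 2 : ℕ))⁻¹ * (if n.Prime then Real.log n / n else 0) =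
      if n.Prime then 1 / (n : ℝ) else 0 := by
    split_ifs with h
    · have hn : (1 : ℝ) < n := by exact_mod_cast h.one_lt
      have hl := Real.log_pos hn
      rw [max_eq_left h.two_le]
      field_simp
    · rw [mul_zero]
  rw [mul_sub, hp]
  ring

/-! ### The Euler product near s = 1 -/

/-- The completely multiplicative function `n ↦ 1 / n ^ s`. -/
noncomputable def natRpowInvHom (s : ℝ) (hs : s ≠ 0) : ℕ →*₀ ℝ where
  toFun n := 1 / (n : ℝ) ^ s
  map_zero' := by simp [Real.zero_rpow hs]
  map_one' := by simp
  map_mul' m n := by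
    rw [Nat.cast_mul, Real.mul_rpow (Nat.cast_nonneg _) (Nat.cast_nonneg _), one_div_mul_one_div]

theorem one_div_rpow_prime_le {p : ℕ} (hp : p.Prime) {s : ℝ} (hs : 1 ≤ s) :
    1 / (p : ℝ) ^ s ≤ 1 / p := by
  have hp1 : (1 : ℝ) ≤ p := by exact_mod_cast hp.one_le
  refine one_div_le_one_div_of_le (by linarith) ?_
  simpa using Real.rpow_le_rpow_of_exponent_le hp1 hs

/-- The logarithm of the Euler product of the zeta function. -/
theorem hasSum_neg_log_one_sub_rpow {s : ℝ} (hs : 1 < s) :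
    HasSum (fun n : ℕ => if n.Prime then -Real.log (1 - 1 / (n : ℝ) ^ s) else 0)
      (Real.log (∑' n : ℕ, 1 / (n : ℝ) ^ s)) := by
  have hsum : Summable fun n : ℕ => 1 / (n : ℝ) ^ s := Real.summable_one_div_nat_rpow.mpr hs
  have hterm : ∀ p : ℕ, p.Prime → 0 < 1 - 1 / (p : ℝ) ^ s := fun p hp => by
    linarith [one_div_rpow_prime_le hp hs.le, one_div_prime_le_half hp]
  have h := EulerProduct.eulerProduct_completely_multiplicative
    (f := natRpowInvHom s (by linarith)) hsum.norm
  have hpos : 0 < ∑' n : ℕ, 1 / (n : ℝ) ^ s :=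
    hsum.tsum_pos (fun n => by positivity) 1 (by simp)
  rw [hasSum_iff_tendsto_nat_of_nonneg]
  · refine (((Real.continuousAt_log hpos.ne').tendsto).comp h).congr fun N => ?_
    rw [Function.comp_apply, Real.log_prod, Nat.primesBelow, Finset.sum_filter]
    · refine Finset.sum_congr rfl fun p _ => ?_
      split_ifs
      · rw [Real.log_inv]
        rfl
      · rfl
    · intro p hp
      exact inv_ne_zero (hterm p (Nat.prime_of_mem_primesBelow hp)).ne'
  · intro p
    split_ifs with hp
    · have h0 : 0 ≤ 1 / (p : ℝ) ^ s := by positivity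
      have := Real.log_nonpos (hterm p hp).le (by linarith)
      linarith
    · rfl

/-- This is the logarithm of (s-1)ζ(s) → 1 at s = 1 + σ. -/
theorem tendsto_log_tsum_rpow_add_log :
    Tendsto (fun σ : ℝ => Real.log (∑' n : ℕ, 1 / (n : ℝ) ^ (1 + σ)) + Real.log σ)
      (𝓝[>] 0) (𝓝 0) := by
  have hshift : Tendsto (fun σ : ℝ => 1 + σ) (𝓝[>] 0) (𝓝[>] 1) := by
    refine tendsto_nhdsWithin_iff.mpr ⟨?_, ?_⟩
    · have : Tendsto (fun σ : ℝ => 1 + σ) (𝓝 0) (𝓝 (1 + 0)) := by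
        exact (continuous_const.add continuous_id).tendsto 0
      rw [add_zero] at this
      exact this.mono_left nhdsWithin_le_nhds
    · filter_upwards [self_mem_nhdsWithin] with σ hσ
      exact lt_add_of_pos_right 1 (Set.mem_Ioi.mp hσ)
  have h := ((Real.continuousAt_log one_ne_zero).tendsto).comp
    (tendsto_sub_mul_tsum_nat_rpow.comp hshift)
  rw [Real.log_one] at h
  refine h.congr' ?_
  filter_upwards [self_mem_nhdsWithin] with σ hσ
  have hσ' : (0 : ℝ) < σ := hσ
  have hsum : Summable fun n : ℕ => 1 / (n : ℝ) ^ (1 + σ) :=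
    Real.summable_one_div_nat_rpow.mpr (by linarith)
  have hpos : 0 < ∑' n : ℕ, 1 / (n : ℝ) ^ (1 + σ) :=
    hsum.tsum_pos (fun n => by positivity) 1 (by simp)
  rw [Function.comp_apply, Function.comp_apply, add_sub_cancel_left,
    Real.log_mul hσ'.ne' hpos.ne', add_comm]

/-- The comparison term between the Dirichlet series of `primeLogWeight` and `log ζ (1 + σ)`. -/
noncomputable def primeLogDefect (σ : ℝ) (n : ℕ) : ℝ :=
  (if n.Prime then -Real.log (1 - 1 / (n : ℝ) ^ (1 + σ)) else 0) -
    primeLogWeight n * (n : ℝ) ^ (-σ)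

/-- The linear terms of both logarithms equal 1/n^(1+σ) and cancel; each remainder lies in [0,
2/n²]. The bound is uniform in σ, as dominated convergence needs. -/
theorem abs_primeLogDefect_le {σ : ℝ} (hσ : 0 ≤ σ) (n : ℕ) :
    |primeLogDefect σ n| ≤ 2 * (1 / (n : ℝ)) ^ 2 := by
  unfold primeLogDefect primeLogWeight
  split_ifs with hp
  · have hp1 : (1 : ℝ) ≤ n := by exact_mod_cast hp.one_le
    have hy := one_div_rpow_prime_le hp (by linarith : 1 ≤ 1 + σ)
    have hx := one_div_prime_le_half hp
    have hu0 : 0 < (n : ℝ) ^ (-σ) := Real.rpow_pos_of_pos (by linarith) _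
    have hu1 : (n : ℝ) ^ (-σ) ≤ 1 := Real.rpow_le_one_of_one_le_of_nonpos hp1 (by linarith)
    have hxy : 1 / (n : ℝ) ^ (1 + σ) = 1 / n * (n : ℝ) ^ (-σ) := by
      rw [Real.rpow_add (by linarith), Real.rpow_one, Real.rpow_neg (by linarith)]
      field_simp
    have h1 := neg_log_one_sub_sub_self_bounds (hy.trans hx)
    have h2 := neg_log_one_sub_sub_self_bounds hx
    have hy0 : 0 ≤ 1 / (n : ℝ) ^ (1 + σ) := by positivity
    have hy2 : (1 / (n : ℝ) ^ (1 + σ)) ^ 2 ≤ (1 / (n : ℝ)) ^ 2 := pow_le_pow_left₀ hy0 hy 2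
    have h3 : 0 ≤ (-Real.log (1 - 1 / (n : ℝ)) - 1 / n) * (n : ℝ) ^ (-σ) :=
      mul_nonneg h2.1 hu0.le
    have h4 : (-Real.log (1 - 1 / (n : ℝ)) - 1 / n) * (n : ℝ) ^ (-σ) ≤ 2 * (1 / (n : ℝ)) ^ 2 :=
      (mul_le_of_le_one_right h2.1 hu1).trans h2.2
    rw [sub_mul, ← hxy] at h3 h4
    rw [abs_le]
    constructor <;> linarith [h1.1, h1.2]
  · rw [zero_mul, sub_zero, abs_zero]
    positivity

theorem summable_primeLogDefect {σ : ℝ} (hσ : 0 ≤ σ) : Summable (primeLogDefect σ) :=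
  Summable.of_norm_bounded summable_two_mul_inv_sq (abs_primeLogDefect_le hσ)

theorem tendsto_tsum_primeLogDefect :
    Tendsto (fun σ : ℝ => ∑' n, primeLogDefect σ n) (𝓝[>] 0) (𝓝 0) := by
  have h0 : (0 : ℝ) = ∑' _ : ℕ, (0 : ℝ) := tsum_zero.symm
  rw [show 𝓝 (0 : ℝ) = 𝓝 (∑' _ : ℕ, (0 : ℝ)) by rw [← h0]]
  refine tendsto_tsum_of_dominated_convergence summable_two_mul_inv_sq (fun n => ?_) ?_
  · have hzero : primeLogDefect 0 n = 0 := by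
      unfold primeLogDefect primeLogWeight
      split_ifs <;> simp
    suffices h : ContinuousAt (fun σ => primeLogDefect σ n) 0 by
      have h' := h.tendsto
      rw [hzero] at h'
      exact h'.mono_left nhdsWithin_le_nhds
    unfold primeLogDefect primeLogWeight
    split_ifs with hp
    · have hn : (n : ℝ) ≠ 0 := by exact_mod_cast hp.ne_zero
      have hc1 : ContinuousAt (fun σ : ℝ => (n : ℝ) ^ (1 + σ)) 0 :=
        continuousAt_const.rpow (continuousAt_const.add continuousAt_id) (Or.inl hn)
      have hc2 : ContinuousAt (fun σ : ℝ => (n : ℝ) ^ (-σ)) 0 :=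
        continuousAt_const.rpow continuousAt_id.neg (Or.inl hn)
      have hne : (n : ℝ) ^ ((1 : ℝ) + 0) ≠ 0 := by simpa using hn
      have hne2 : 1 - 1 / (n : ℝ) ^ ((1 : ℝ) + 0) ≠ 0 := by
        have := one_div_prime_le_half hp
        rw [add_zero, Real.rpow_one]
        linarith
      have hc3 : ContinuousAt (fun σ : ℝ => 1 - 1 / (n : ℝ) ^ (1 + σ)) 0 :=
        continuousAt_const.sub (continuousAt_const.div hc1 hne)
      exact (hc3.log hne2).neg.sub (continuousAt_const.mul hc2)
    · simpa using continuousAt_const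
  · filter_upwards [self_mem_nhdsWithin] with σ hσ n
    exact abs_primeLogDefect_le (le_of_lt hσ) n

theorem hasSum_primeLogWeight_rpow {σ : ℝ} (hσ : 0 < σ) :
    HasSum (fun n : ℕ => primeLogWeight n * (n : ℝ) ^ (-σ))
      (Real.log (∑' n : ℕ, 1 / (n : ℝ) ^ (1 + σ)) - ∑' n, primeLogDefect σ n) := by
  refine ((hasSum_neg_log_one_sub_rpow (by linarith : 1 < 1 + σ)).sub
    (summable_primeLogDefect hσ.le).hasSum).congr_fun ?_
  intro n
  unfold primeLogDefect
  ring

theorem tendsto_tsum_primeLogWeight_rpow_add_log :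
    Tendsto (fun σ : ℝ => ∑' n : ℕ, primeLogWeight n * (n : ℝ) ^ (-σ) + Real.log σ)
      (𝓝[>] 0) (𝓝 0) := by
  have h := tendsto_log_tsum_rpow_add_log.sub tendsto_tsum_primeLogDefect
  rw [sub_zero] at h
  refine h.congr' ?_
  filter_upwards [self_mem_nhdsWithin] with σ hσ
  rw [(hasSum_primeLogWeight_rpow hσ).tsum_eq]
  ring

/-! ### Abel summation and the constant γ -/

/-- Rounding log n up turns the Dirichlet series into a power series in e^(-σ), at the cost of a
factor at least e^(-σ). -/
theorem exp_neg_mul_ceil_log_bounds {σ : ℝ} (hσ : 0 ≤ σ) {n : ℕ} (hn : 1 ≤ n) :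
    Real.exp (-σ) * (n : ℝ) ^ (-σ) ≤ Real.exp (-σ) ^ ⌈Real.log n⌉₊ ∧
      Real.exp (-σ) ^ ⌈Real.log n⌉₊ ≤ (n : ℝ) ^ (-σ) := by
  have hn' : (1 : ℝ) ≤ n := by exact_mod_cast hn
  have h1 := Nat.le_ceil (Real.log n)
  have h2 := (Nat.ceil_lt_add_one (Real.log_nonneg hn')).le
  rw [← Real.exp_nat_mul, Real.rpow_def_of_pos (by linarith), ← Real.exp_add, Real.exp_le_exp,
    Real.exp_le_exp]
  constructor <;> nlinarith

theorem primeLogWeight_mul_exp_bounds {σ : ℝ} (hσ : 0 ≤ σ) (n : ℕ) :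
    Real.exp (-σ) * (primeLogWeight n * (n : ℝ) ^ (-σ)) ≤
        primeLogWeight n * Real.exp (-σ) ^ ⌈Real.log n⌉₊ ∧
      primeLogWeight n * Real.exp (-σ) ^ ⌈Real.log n⌉₊ ≤ primeLogWeight n * (n : ℝ) ^ (-σ) := by
  rcases Nat.eq_zero_or_pos n with rfl | hn
  · simp [primeLogWeight]
  · have h := exp_neg_mul_ceil_log_bounds hσ hn
    rw [mul_left_comm]
    exact ⟨mul_le_mul_of_nonneg_left h.1 (primeLogWeight_nonneg n),
      mul_le_mul_of_nonneg_left h.2 (primeLogWeight_nonneg n)⟩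

theorem summable_primeLogWeight_mul_exp {σ : ℝ} (hσ : 0 < σ) :
    Summable fun n : ℕ => primeLogWeight n * Real.exp (-σ) ^ ⌈Real.log n⌉₊ :=
  Summable.of_nonneg_of_le
    (fun n => mul_nonneg (primeLogWeight_nonneg n) (pow_nonneg (Real.exp_pos _).le _))
    (fun n => (primeLogWeight_mul_exp_bounds hσ.le n).2) (hasSum_primeLogWeight_rpow hσ).summable

theorem tendsto_tsum_primeLogWeight_exp_add_log :
    Tendsto (fun σ : ℝ => ∑' n : ℕ, primeLogWeight n * Real.exp (-σ) ^ ⌈Real.log n⌉₊ +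
      Real.log σ) (𝓝[>] 0) (𝓝 0) := by
  have hZ := tendsto_tsum_primeLogWeight_rpow_add_log
  have hσ0 : Tendsto (fun σ : ℝ => σ) (𝓝[>] 0) (𝓝 0) := nhdsWithin_le_nhds
  have hlogmul : Tendsto (fun σ : ℝ => Real.log σ * σ) (𝓝[>] 0) (𝓝 0) := by
    simpa only [Real.rpow_one] using tendsto_log_mul_rpow_nhdsGT_zero zero_lt_one
  -- Writing Z for the Dirichlet series, this is (1-σ)Z + log σ, arranged so that only Z + log σ and
  -- σ log σ occur.
  have hlow : Tendsto (fun σ : ℝ => (∑' n : ℕ, primeLogWeight n * (n : ℝ) ^ (-σ) + Real.log σ) -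
      (σ * (∑' n : ℕ, primeLogWeight n * (n : ℝ) ^ (-σ) + Real.log σ) - Real.log σ * σ))
      (𝓝[>] 0) (𝓝 0) := by
    have := hZ.sub ((hσ0.mul hZ).sub hlogmul)
    simpa using this
  refine tendsto_of_tendsto_of_tendsto_of_le_of_le' hlow hZ ?_ ?_
  · filter_upwards [self_mem_nhdsWithin] with σ hσ
    have hσ' : (0 : ℝ) < σ := hσ
    have hs := (hasSum_primeLogWeight_rpow hσ').summable
    have h1 : Real.exp (-σ) * ∑' n : ℕ, primeLogWeight n * (n : ℝ) ^ (-σ) ≤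
        ∑' n : ℕ, primeLogWeight n * Real.exp (-σ) ^ ⌈Real.log n⌉₊ := by
      rw [← tsum_mul_left]
      exact (hs.mul_left _).tsum_le_tsum
        (fun n => (primeLogWeight_mul_exp_bounds hσ'.le n).1)
        (summable_primeLogWeight_mul_exp hσ')
    have h2 : 0 ≤ ∑' n : ℕ, primeLogWeight n * (n : ℝ) ^ (-σ) :=
      tsum_nonneg fun n => mul_nonneg (primeLogWeight_nonneg n)
        (Real.rpow_nonneg (Nat.cast_nonneg n) _)
    have h3 : 1 - σ ≤ Real.exp (-σ) := by linarith [Real.add_one_le_exp (-σ)]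
    have h4 := mul_le_mul_of_nonneg_right h3 h2
    linarith
  · filter_upwards [self_mem_nhdsWithin] with σ hσ
    have hσ' : (0 : ℝ) < σ := hσ
    exact add_le_add_left ((summable_primeLogWeight_mul_exp hσ').tsum_le_tsum
      (fun n => (primeLogWeight_mul_exp_bounds hσ'.le n).2)
      (hasSum_primeLogWeight_rpow hσ').summable) _

/-- The integers `n` with `⌈log n⌉ = m`. -/
noncomputable def ceilLogFiber (m : ℕ) : Finset ℕ :=
  (Finset.range (⌊Real.exp m⌋₊ + 1)).filter fun n => ⌈Real.log n⌉₊ = m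

theorem ceil_log_le_iff {n m : ℕ} : ⌈Real.log n⌉₊ ≤ m ↔ n ≤ ⌊Real.exp m⌋₊ := by
  rcases Nat.eq_zero_or_pos n with rfl | hn
  · simp
  · rw [Nat.ceil_le, Nat.le_floor_iff (Real.exp_pos _).le,
      Real.log_le_iff_le_exp (by exact_mod_cast hn)]

theorem mem_ceilLogFiber {n m : ℕ} : n ∈ ceilLogFiber m ↔ ⌈Real.log n⌉₊ = m := by
  rw [ceilLogFiber, Finset.mem_filter, Finset.mem_range, Nat.lt_succ_iff]
  exact ⟨fun h => h.2, fun h => ⟨ceil_log_le_iff.mp h.le, h⟩⟩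

theorem sum_range_sum_ceilLogFiber (f : ℕ → ℝ) (M : ℕ) :
    ∑ m ∈ Finset.range (M + 1), ∑ n ∈ ceilLogFiber m, f n =
      ∑ n ∈ Finset.range (⌊Real.exp M⌋₊ + 1), f n := by
  rw [← Finset.sum_fiberwise_of_maps_to (s := Finset.range (⌊Real.exp M⌋₊ + 1))
    (t := Finset.range (M + 1)) (g := fun n : ℕ => ⌈Real.log n⌉₊)]
  · refine Finset.sum_congr rfl fun m hm => Finset.sum_congr ?_ fun _ _ => rfl
    ext n
    rw [mem_ceilLogFiber, Finset.mem_filter, Finset.mem_range, Nat.lt_succ_iff,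
      ← ceil_log_le_iff]
    rw [Finset.mem_range, Nat.lt_succ_iff] at hm
    exact ⟨fun h => ⟨h.le.trans hm, h⟩, fun h => h.2⟩
  · intro n hn
    rw [Finset.mem_range, Nat.lt_succ_iff] at hn ⊢
    exact ceil_log_le_iff.mpr hn

theorem hasSum_sum_ceilLogFiber {σ : ℝ} (hσ : 0 < σ) :
    HasSum (fun m : ℕ => (∑ n ∈ ceilLogFiber m, primeLogWeight n) * Real.exp (-σ) ^ m)
      (∑' n : ℕ, primeLogWeight n * Real.exp (-σ) ^ ⌈Real.log n⌉₊) := by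
  have h := (summable_primeLogWeight_mul_exp hσ).hasSum.tsum_fiberwise
    fun n : ℕ => ⌈Real.log n⌉₊
  refine h.congr_fun fun m => ?_
  have hset : (fun n : ℕ => ⌈Real.log n⌉₊) ⁻¹' {m} = (ceilLogFiber m : Set ℕ) := by
    ext n
    simp [mem_ceilLogFiber]
  rw [hset, Finset.tsum_subtype' (ceilLogFiber m)
    fun n : ℕ => primeLogWeight n * Real.exp (-σ) ^ ⌈Real.log n⌉₊, Finset.sum_mul]
  refine Finset.sum_congr rfl fun n hn => ?_
  rw [mem_ceilLogFiber.mp hn]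

theorem hasSum_pow_div {x : ℝ} (h0 : 0 ≤ x) (h1 : x < 1) :
    HasSum (fun m : ℕ => (1 / (m : ℝ)) * x ^ m) (-Real.log (1 - x)) := by
  rw [← hasSum_nat_add_iff' 1]
  have h := Real.hasSum_pow_div_log_of_abs_lt_one (abs_lt.mpr ⟨by linarith, h1⟩)
  simp only [Finset.range_one, Finset.sum_singleton, Nat.cast_zero, div_zero, zero_mul, sub_zero]
  refine h.congr_fun fun m => ?_
  push_cast
  ring

theorem tendsto_log_one_sub_exp_neg_sub_log :
    Tendsto (fun σ : ℝ => Real.log (1 - Real.exp (-σ)) - Real.log σ) (𝓝[>] 0) (𝓝 0) := by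
  have hd : HasDerivAt (fun σ : ℝ => 1 - Real.exp (-σ)) 1 0 := by
    have := ((hasDerivAt_id (0 : ℝ)).neg.exp).const_sub 1
    simpa using this
  have h := (hasDerivAt_iff_tendsto_slope.mp hd).mono_left
    (nhdsWithin_mono 0 fun σ (hσ : (0 : ℝ) < σ) => hσ.ne')
  have h2 := ((Real.continuousAt_log one_ne_zero).tendsto).comp h
  rw [Real.log_one] at h2
  refine h2.congr' ?_
  filter_upwards [self_mem_nhdsWithin] with σ hσ
  have hσ' : (0 : ℝ) < σ := hσ
  have h3 : 0 < 1 - Real.exp (-σ) := by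
    rw [sub_pos, Real.exp_lt_one_iff]
    linarith
  rw [Function.comp_apply, slope_def_field, neg_zero, Real.exp_zero, sub_self, sub_zero, sub_zero,
    Real.log_div h3.ne' hσ'.ne']

theorem tendsto_log_log_floor_exp_sub_log :
    Tendsto (fun M : ℕ => Real.log (Real.log ((⌊Real.exp M⌋₊ + 1 : ℕ) : ℝ)) - Real.log M)
      atTop (𝓝 0) := by
  have h1 := (Real.tendsto_log_comp_add_sub_log 1).comp tendsto_natCast_atTop_atTop
  refine tendsto_of_tendsto_of_tendsto_of_le_of_le' tendsto_const_nhds h1 ?_ ?_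
  all_goals
    filter_upwards [eventually_ge_atTop 1] with M hM
    have hM' : (1 : ℝ) ≤ M := by exact_mod_cast hM
    have hpos : 0 < Real.exp M := Real.exp_pos _
    have hf := Nat.lt_floor_add_one (Real.exp M)
    have hlow : (M : ℝ) ≤ Real.log ((⌊Real.exp M⌋₊ + 1 : ℕ) : ℝ) := by
      push_cast
      rw [Real.le_log_iff_exp_le (by positivity)]
      exact hf.le
  · exact sub_nonneg.mpr (Real.log_le_log (by linarith) hlow)
  · refine sub_le_sub_right (Real.log_le_log (by linarith) ?_) _
    have hfl := Nat.floor_le hpos.le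
    have he : Real.exp M + 1 ≤ Real.exp (M + 1) := by
      rw [Real.exp_add]
      nlinarith [Real.add_one_le_exp (1 : ℝ), Real.one_le_exp (zero_le_one.trans hM')]
    push_cast
    rw [Real.log_le_iff_le_exp (by positivity)]
    linarith

/-- Mertens' theorem in logarithmic form. -/
theorem tendsto_sum_primeLogWeight_sub_log_log :
    Tendsto (fun N : ℕ => ∑ n ∈ Finset.range N, primeLogWeight n - Real.log (Real.log N))
      atTop (𝓝 Real.eulerMascheroniConstant) := by
  obtain ⟨l, hl⟩ := exists_tendsto_sum_primeLogWeight_sub_log_log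
  have hfloor : Tendsto (fun M : ℕ => ⌊Real.exp M⌋₊ + 1) atTop atTop :=
    tendsto_atTop_mono (fun M => Nat.le_succ _) (tendsto_nat_floor_atTop.comp
      (Real.tendsto_exp_atTop.comp tendsto_natCast_atTop_atTop))
  -- Up to ⌈log n⌉ = M the weights sum to log M + l + o(1), and the harmonic sum is log M + γ +
  -- o(1).
  have hpartial : Tendsto (fun N : ℕ => ∑ m ∈ Finset.range N,
      (∑ n ∈ ceilLogFiber m, primeLogWeight n - 1 / (m : ℝ))) atTop
      (𝓝 (l - Real.eulerMascheroniConstant)) := by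
    rw [← tendsto_add_atTop_iff_nat 1]
    have h := ((hl.comp hfloor).add tendsto_log_log_floor_exp_sub_log).sub
      Real.tendsto_harmonic_sub_log
    rw [add_zero] at h
    refine h.congr fun M => ?_
    rw [Finset.sum_sub_distrib, sum_range_sum_ceilLogFiber,
      Finset.sum_range_succ' fun m : ℕ => 1 / (m : ℝ), harmonic]
    simp only [Function.comp_apply]
    push_cast
    simp only [one_div, div_zero]
    ring
  have habel := Real.tendsto_tsum_powerSeries_nhdsWithin_lt hpartial
  have hexp : Tendsto (fun σ : ℝ => Real.exp (-σ)) (𝓝[>] 0) (𝓝[<] 1) := by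
    refine tendsto_nhdsWithin_iff.mpr ⟨?_, ?_⟩
    · have : Tendsto (fun σ : ℝ => Real.exp (-σ)) (𝓝 0) (𝓝 (Real.exp (-0))) :=
        (Real.continuous_exp.comp continuous_neg).tendsto 0
      rw [neg_zero, Real.exp_zero] at this
      exact this.mono_left nhdsWithin_le_nhds
    · filter_upwards [self_mem_nhdsWithin] with σ hσ
      exact Real.exp_lt_one_iff.mpr (neg_lt_zero.mpr hσ)
  have hzero := tendsto_tsum_primeLogWeight_exp_add_log.add tendsto_log_one_sub_exp_neg_sub_log
  rw [add_zero] at hzero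
  -- By Abel the power series at x = e^(-σ) tends to l - γ. It also equals the rounded series plus
  -- log(1-x), which tends to 0.
  have hlim : l - Real.eulerMascheroniConstant = 0 := by
    refine tendsto_nhds_unique (habel.comp hexp) (hzero.congr' ?_)
    filter_upwards [self_mem_nhdsWithin] with σ hσ
    have h := (hasSum_sum_ceilLogFiber hσ).sub (hasSum_pow_div (Real.exp_pos (-σ)).le
      (Real.exp_lt_one_iff.mpr (neg_lt_zero.mpr hσ)))
    rw [Function.comp_apply, (h.congr_fun fun m => by ring :
      HasSum (fun m : ℕ => (∑ n ∈ ceilLogFiber m, primeLogWeight n - 1 / (m : ℝ)) *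
        Real.exp (-σ) ^ m) _).tsum_eq]
    ring
  rwa [sub_eq_zero.mp hlim] at hl

/-! ### Mertens and Chebyshev along the primes -/

theorem range_nth_prime_filter (k : ℕ) :
    (Finset.range (Nat.nth Nat.Prime k)).filter Nat.Prime =
      (Finset.range k).image (Nat.nth Nat.Prime) := by
  ext p
  simp only [Finset.mem_filter, Finset.mem_range, Finset.mem_image]
  constructor
  · rintro ⟨hlt, hp⟩
    exact ⟨Nat.count Nat.Prime p, (Nat.nth_strictMono Nat.infinite_setOfPred_prime).lt_iff_lt.mp
      ((Nat.nth_count hp).symm ▸ hlt), Nat.nth_count hp⟩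
  · rintro ⟨i, hi, rfl⟩
    exact ⟨Nat.nth_strictMono Nat.infinite_setOfPred_prime hi, Nat.prime_nth_prime i⟩

theorem tendsto_nth_prime_atTop : Tendsto (Nat.nth Nat.Prime) atTop atTop :=
  (Nat.nth_strictMono Nat.infinite_setOfPred_prime).tendsto_atTop

/-- Mertens' third theorem along the sequence of primes. -/
theorem tendsto_prod_one_sub_inv_nth_prime_mul_log :
    Tendsto (fun k : ℕ => (∏ i ∈ Finset.range k, (1 - 1 / (Nat.nth Nat.Prime i : ℝ))) *
      Real.log (Nat.nth Nat.Prime k)) atTop (𝓝 (Real.exp (-Real.eulerMascheroniConstant))) := by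
  have h := (tendsto_sum_primeLogWeight_sub_log_log.comp tendsto_nth_prime_atTop).neg.rexp
  refine h.congr fun k => ?_
  have hlog : 0 < Real.log (Nat.nth Nat.Prime k) :=
    Real.log_pos (by exact_mod_cast (Nat.prime_nth_prime k).one_lt)
  simp only [Function.comp_apply]
  rw [neg_sub, sub_eq_add_neg, Real.exp_add, Real.exp_log hlog, mul_comm]
  congr 1
  simp only [primeLogWeight]
  rw [← Finset.sum_filter, range_nth_prime_filter,
    Finset.sum_image fun a _ b _ h => Nat.nth_injective Nat.infinite_setOfPred_prime h,
    ← Finset.sum_neg_distrib, Real.exp_sum]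
  refine Finset.prod_congr rfl fun i _ => ?_
  rw [neg_neg, Real.exp_log]
  linarith [one_div_prime_le_half (Nat.prime_nth_prime i)]

theorem eventually_half_le_theta_sub_log :
    ∀ᶠ N : ℕ in atTop, (N : ℝ) / 2 ≤ Chebyshev.theta N - Real.log N := by
  have hlo := (isLittleO_log_rpow_atTop (r := 1 / 2) (by norm_num)).bound
    (by norm_num : (0 : ℝ) < 1 / 100)
  filter_upwards [tendsto_natCast_atTop_atTop.eventually hlo, eventually_ge_atTop 100] with N hN hN1
  have hN2 : (100 : ℝ) ≤ N := by exact_mod_cast hN1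
  have hlog0 : 0 ≤ Real.log N := Real.log_natCast_nonneg N
  rw [Real.norm_of_nonneg hlog0, Real.norm_of_nonneg (Real.rpow_nonneg (by linarith) _),
    ← Real.sqrt_eq_rpow] at hN
  have hs : √(N : ℝ) * √(N : ℝ) = N := Real.mul_self_sqrt (by linarith)
  have hs1 : 1 ≤ √(N : ℝ) := Real.one_le_sqrt.mpr (by linarith)
  have h1 : √(N : ℝ) * Real.log N ≤ 1 / 100 * N := by nlinarith
  have h2 : Real.log N ≤ 1 / 100 * N := by nlinarith
  have h3 : Real.log ((N : ℝ) + 1) ≤ Real.log 2 + Real.log N := by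
    rw [← Real.log_mul (by norm_num) (by linarith)]
    exact Real.log_le_log (by linarith) (by linarith)
  have h4 := Chebyshev.theta_ge N
  have h5 := Real.log_two_gt_d9
  have h6 := Real.log_two_lt_d9
  nlinarith

theorem log_primeProd (k : ℕ) :
    Real.log (primeProd k : ℝ) =
      Chebyshev.theta (Nat.nth Nat.Prime k) - Real.log (Nat.nth Nat.Prime k) := by
  have hk := Nat.prime_nth_prime k
  have hset : Nat.primesLE (Nat.nth Nat.Prime k) =
      insert (Nat.nth Nat.Prime k) ((Finset.range k).image (Nat.nth Nat.Prime)) := by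
    rw [← range_nth_prime_filter]
    ext p
    simp only [Nat.mem_primesLE, Finset.mem_insert, Finset.mem_filter, Finset.mem_range]
    constructor
    · rintro ⟨h1, h2⟩
      exact h1.eq_or_lt.imp id fun h => ⟨h, h2⟩
    · rintro (rfl | ⟨h1, h2⟩)
      · exact ⟨le_rfl, hk⟩
      · exact ⟨h1.le, h2⟩
  have hmem : Nat.nth Nat.Prime k ∉ (Finset.range k).image (Nat.nth Nat.Prime) := by
    rw [← range_nth_prime_filter]
    simp
  rw [Chebyshev.theta_eq_sum_primesLE_log, hset, Finset.sum_insert hmem, add_sub_cancel_left,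
    Finset.sum_image fun a _ b _ h => nth_prime_injective h, primeProd]
  push_cast
  rw [Real.log_prod]
  exact fun i _ => by exact_mod_cast (Nat.prime_nth_prime i).ne_zero

/-- With N the first prime not dividing n_k, log(2n_k) lies between N/2 and 2N, so its logarithm is
within log 2 < 2 of log N. -/
theorem tendsto_log_log_two_mul_primeProd_div_log :
    Tendsto (fun k : ℕ => Real.log (Real.log ((2 * primeProd k : ℕ) : ℝ)) /
      Real.log (Nat.nth Nat.Prime k)) atTop (𝓝 1) := by
  have hlog : Tendsto (fun k : ℕ => Real.log (Nat.nth Nat.Prime k)) atTop atTop :=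
    Real.tendsto_log_atTop.comp (tendsto_natCast_atTop_atTop.comp tendsto_nth_prime_atTop)
  rw [← tendsto_sub_nhds_zero_iff]
  refine squeeze_zero_norm' ?_ (hlog.const_div_atTop 2)
  filter_upwards [tendsto_nth_prime_atTop.eventually eventually_half_le_theta_sub_log] with k hk
  set N := Nat.nth Nat.Prime k
  have hN : (2 : ℝ) ≤ N := by exact_mod_cast (Nat.prime_nth_prime k).two_le
  have hlogN : 0 < Real.log N := Real.log_pos (by linarith)
  have htheta := Chebyshev.theta_le_log4_mul_x (x := (N : ℝ)) (by linarith)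
  have hlog4 : Real.log 4 = 2 * Real.log 2 := by
    rw [← Real.log_rpow (by norm_num)]
    norm_num
  have h2 := Real.log_two_lt_d9
  have h20 := Real.log_two_gt_d9
  have hval : Real.log ((2 * primeProd k : ℕ) : ℝ) =
      Real.log 2 + (Chebyshev.theta N - Real.log N) := by
    rw [← log_primeProd, ← Real.log_mul (by norm_num)
      (by exact_mod_cast (primeProd_pos k).ne')]
    push_cast
    rfl
  have hlow : (N : ℝ) / 2 ≤ Real.log ((2 * primeProd k : ℕ) : ℝ) := by linarith
  have hup : Real.log ((2 * primeProd k : ℕ) : ℝ) ≤ N * 2 := by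
    rw [hval]
    nlinarith
  have hlow' := Real.log_le_log (by linarith) hlow
  have hup' := Real.log_le_log (by linarith) hup
  rw [Real.log_div (by linarith) (by norm_num)] at hlow'
  rw [Real.log_mul (by linarith) (by norm_num)] at hup'
  rw [div_sub_one hlogN.ne', norm_div, Real.norm_of_nonneg hlogN.le, Real.norm_eq_abs]
  refine div_le_div_of_nonneg_right (abs_le.mpr ⟨?_, ?_⟩) hlogN.le <;> linarith

/-! ### The limit along 2n_k -/

/-- The odd primes, enumerated in increasing order. -/
noncomputable def oddPrimeEquiv : ℕ ≃ {p : ℕ // p.Prime ∧ 2 < p} :=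
  Equiv.ofBijective (fun i => ⟨Nat.nth Nat.Prime (i + 1), Nat.prime_nth_prime _, by
    rw [← Nat.nth_prime_zero_eq_two]
    exact Nat.nth_strictMono Nat.infinite_setOfPred_prime (Nat.succ_pos i)⟩) <| by
  constructor
  · intro i j h
    exact Nat.succ_injective (nth_prime_injective (congrArg Subtype.val h))
  · rintro ⟨p, hp, hp2⟩
    have hc : Nat.count Nat.Prime p ≠ 0 := fun h => by
      have := Nat.nth_count hp
      rw [h, Nat.nth_prime_zero_eq_two] at this
      omega
    obtain ⟨i, hi⟩ := Nat.exists_eq_succ_of_ne_zero hc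
    exact ⟨i, Subtype.ext ((congrArg _ hi).symm.trans (Nat.nth_count hp))⟩

theorem tendsto_prod_twinPrimeFactor :
    Tendsto (fun k : ℕ => ∏ i ∈ Finset.range k,
      (Nat.nth Nat.Prime (i + 1) : ℝ) * ((Nat.nth Nat.Prime (i + 1) : ℝ) - 2) /
        ((Nat.nth Nat.Prime (i + 1) : ℝ) - 1) ^ 2) atTop (𝓝 twinPrimeConstant) :=
  (oddPrimeEquiv.hasProd_iff.mpr multipliable_twinPrimeConstant.hasProd).tendsto_prod_nat

/-- The prime 2 is split off: it has no twin prime factor, and 1/2 = 1 - 1/2. -/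
theorem prod_minLocalProportion_succ (k : ℕ) :
    ∏ i ∈ Finset.range (k + 1), minLocalProportion (Nat.nth Nat.Prime i) =
      (∏ i ∈ Finset.range k,
        (Nat.nth Nat.Prime (i + 1) : ℝ) * ((Nat.nth Nat.Prime (i + 1) : ℝ) - 2) /
          ((Nat.nth Nat.Prime (i + 1) : ℝ) - 1) ^ 2) *
      ∏ i ∈ Finset.range (k + 1), (1 - 1 / (Nat.nth Nat.Prime i : ℝ)) := by
  rw [Finset.prod_range_succ', Finset.prod_range_succ' _ k, ← mul_assoc,
    ← Finset.prod_mul_distrib, Nat.nth_prime_zero_eq_two]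
  congr 1
  · refine Finset.prod_congr rfl fun i _ => ?_
    have h2 := (oddPrimeEquiv i).2.2
    change 2 < Nat.nth Nat.Prime (i + 1) at h2
    have h2' : (2 : ℝ) < Nat.nth Nat.Prime (i + 1) := by exact_mod_cast h2
    have h3 : (Nat.nth Nat.Prime (i + 1) : ℝ) - 1 ≠ 0 := by linarith
    have h4 : (Nat.nth Nat.Prime (i + 1) : ℝ) ≠ 0 := by linarith
    rw [minLocalProportion, if_neg h2.ne']
    field_simp
  · norm_num [minLocalProportion]

theorem tendsto_primitiveProportion_two_mul_primeProd :
    Tendsto (fun k : ℕ => primitiveProportion (2 * primeProd k) *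
        Real.log (Real.log ((2 * primeProd k : ℕ) : ℝ))) atTop
      (𝓝 (twinPrimeConstant * Real.exp (-Real.eulerMascheroniConstant))) := by
  rw [← tendsto_add_atTop_iff_nat 1]
  have h := (tendsto_prod_twinPrimeFactor.mul
    ((tendsto_add_atTop_iff_nat 1).mpr tendsto_prod_one_sub_inv_nth_prime_mul_log)).mul
    ((tendsto_add_atTop_iff_nat 1).mpr tendsto_log_log_two_mul_primeProd_div_log)
  rw [mul_one] at h
  refine h.congr fun k => ?_
  have hlog : Real.log (Nat.nth Nat.Prime (k + 1)) ≠ 0 :=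
    (Real.log_pos (by exact_mod_cast (Nat.prime_nth_prime (k + 1)).one_lt)).ne'
  rw [primitiveProportion_two_mul_primeProd k.succ_pos, prod_minLocalProportion_succ]
  field_simp

/-! ### The lower limit -/

theorem minLocalProportion_le_one {p : ℕ} (hp : p.Prime) : minLocalProportion p ≤ 1 := by
  have h2 : (2 : ℝ) ≤ p := by exact_mod_cast hp.two_le
  unfold minLocalProportion
  split_ifs
  · norm_num
  · rw [div_le_one (by linarith)]
    linarith

theorem antitone_prod_minLocalProportion :
    Antitone fun k : ℕ => ∏ i ∈ Finset.range k, minLocalProportion (Nat.nth Nat.Prime i) :=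
  antitone_nat_of_succ_le fun k => by
    rw [Finset.prod_range_succ]
    exact mul_le_of_le_one_right
      (Finset.prod_nonneg fun i _ => (minLocalProportion_pos (Nat.prime_nth_prime i)).le)
      (minLocalProportion_le_one (Nat.prime_nth_prime k))

/-- If ω(n) is large, the value at 2n_k with k = ω(n) is a lower bound and already at least c.
Otherwise ρ(n) ≥ δ > 0, and log log n → ∞ suffices. -/
theorem eventually_lt_primitiveProportion_mul_loglog {c : ℝ}
    (hc : c < twinPrimeConstant * Real.exp (-Real.eulerMascheroniConstant)) :
    ∀ᶠ n : ℕ in atTop ⊓ 𝓟 {n : ℕ | ¬ n ≡ 2 [MOD 4]},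
      c ≤ primitiveProportion n * Real.log (Real.log (n : ℝ)) := by
  obtain ⟨K, hK⟩ := eventually_atTop.mp
    (tendsto_primitiveProportion_two_mul_primeProd.eventually_const_le hc)
  -- The 2 ensures k > 1 in the comparison with 2n_k.
  set δ := ∏ i ∈ Finset.range (max K 2), minLocalProportion (Nat.nth Nat.Prime i)
  have hδ : 0 < δ := Finset.prod_pos fun i _ => minLocalProportion_pos (Nat.prime_nth_prime i)
  have hloglog : Tendsto (fun n : ℕ => Real.log (Real.log (n : ℝ))) atTop atTop :=
    Real.tendsto_log_atTop.comp (Real.tendsto_log_atTop.comp tendsto_natCast_atTop_atTop)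
  rw [eventually_inf_principal]
  filter_upwards [hloglog.eventually_ge_atTop (c / δ), hloglog.eventually_ge_atTop 0,
    eventually_ne_atTop 0] with n h1 h2 hn0 hn
  rcases le_or_gt (max K 2) (ArithmeticFunction.cardDistinctFactors n) with h | h
  · exact (hK _ ((le_max_left K 2).trans h)).trans
      (primitiveProportion_mul_loglog_le (le_of_max_le_right h) hn rfl)
  · rw [cardDistinctFactors_eq_card_primeFactors] at h
    have h3 : δ ≤ primitiveProportion n :=
      (antitone_prod_minLocalProportion h.le).trans (prod_nth_minLocalProportion_le hn0 hn)
    rw [div_le_iff₀ hδ] at h1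
    have := mul_le_mul_of_nonneg_right h3 h2
    linarith

theorem le_primeProd (k : ℕ) : k ≤ primeProd k := by
  have h : 2 ^ k ≤ primeProd k := by
    rw [primeProd, ← Finset.card_range k, ← Finset.prod_const, Finset.card_range]
    exact Finset.prod_le_prod' fun i _ => (Nat.prime_nth_prime i).two_le
  exact k.lt_two_pow_self.le.trans h

theorem tendsto_two_mul_primeProd :
    Tendsto (fun k : ℕ => 2 * primeProd k) atTop
      (atTop ⊓ 𝓟 {n : ℕ | ¬ n ≡ 2 [MOD 4]}) := by
  refine tendsto_inf.mpr ⟨?_, tendsto_principal.mpr ?_⟩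
  · exact tendsto_atTop_mono (fun k => (le_primeProd k).trans (by omega)) tendsto_id
  · filter_upwards [eventually_gt_atTop 0] with k hk
    exact two_mul_primeProd_not_modEq hk

/-- The sequence 2n_k gives the upper bound; the eventual bound for every smaller real c gives the
lower one. -/
theorem liminf_primitiveProportion_mul_loglog :
    liminf (fun n : ℕ => ((primitiveProportion n * Real.log (Real.log (n : ℝ)) : ℝ) : EReal))
        (atTop ⊓ 𝓟 {n : ℕ | ¬ n ≡ 2 [MOD 4]})
      = ((twinPrimeConstant * Real.exp (-Real.eulerMascheroniConstant) : ℝ) : EReal) := by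
  refine le_antisymm ?_ (le_of_forall_lt fun c hc => ?_)
  · have h := (continuous_coe_real_ereal.tendsto _).comp
      tendsto_primitiveProportion_two_mul_primeProd
    rw [← h.liminf_eq]
    exact liminf_le_liminf_of_le tendsto_two_mul_primeProd
  · obtain ⟨x, hcx, hx⟩ := EReal.lt_iff_exists_real_btwn.mp hc
    refine hcx.trans_le (le_liminf_of_le (by isBoundedDefault) ?_)
    filter_upwards [eventually_lt_primitiveProportion_mul_loglog (EReal.coe_lt_coe_iff.mp hx)]
      with n hn
    exact EReal.coe_le_coe_iff.mpr hn

theorem mainTheorem2 :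
    -- the minimal order of the proportion of primitive characters
    Filter.liminf
        (fun n : ℕ => ((primitiveProportion n * Real.log (Real.log (n : ℝ)) : ℝ) : EReal))
        (Filter.atTop ⊓ Filter.principal {n : ℕ | ¬ n ≡ 2 [MOD 4]})
      = ((twinPrimeConstant * Real.exp (-Real.eulerMascheroniConstant) : ℝ) : EReal) ∧
    -- for each fixed `k > 1`, the minimum over `n ≢ 2 (mod 4)`, `ω(n) = k` is attained at `2 n_k`
    (∀ k : ℕ, 1 < k →
      (¬ 2 * primeProd k ≡ 2 [MOD 4] ∧
        ArithmeticFunction.cardDistinctFactors (2 * primeProd k) = k) ∧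
      ∀ n : ℕ, ¬ n ≡ 2 [MOD 4] → ArithmeticFunction.cardDistinctFactors n = k →
        primitiveProportion (2 * primeProd k) *
            Real.log (Real.log ((2 * primeProd k : ℕ) : ℝ))
          ≤ primitiveProportion n * Real.log (Real.log (n : ℝ))) ∧
    -- the limit along `2 n_k`
    Filter.Tendsto
      (fun k : ℕ => primitiveProportion (2 * primeProd k) *
        Real.log (Real.log ((2 * primeProd k : ℕ) : ℝ)))
      Filter.atTop
      (nhds (twinPrimeConstant * Real.exp (-Real.eulerMascheroniConstant))) :=
  ⟨liminf_primitiveProportion_mul_loglog,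
    fun _ hk => ⟨⟨two_mul_primeProd_not_modEq (by omega),
      cardDistinctFactors_two_mul_primeProd (by omega)⟩,
      fun _ hn hω => primitiveProportion_mul_loglog_le hk hn hω⟩,
    tendsto_primitiveProportion_two_mul_primeProd⟩
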